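/- Let $\gamma : S^1 \to \mathbb{R}^2$ be a Jordan curve, that is, a continuous injective map; no further regularity is assumed. Call a set of four distinct points of $\gamma(S^1)$ that are the vertices of a rhombus in $\mathbb{R}^2$ (a quadrilateral with four sides of equal length) an inscribed rhombus of $\gamma$. Then the set of all inscribed rhombi of $\gamma$ is uncountable. -/

import Mathlib

/-- A Jordan curve in the Euclidean plane: a continuous injective map from the circle. -/
def IsJordanCurve (γ : Circle → EuclideanSpace ℝ (Fin 2)) : Prop :=
  Continuous γ ∧ Function.Injective γ

/-- `s` is the vertex set of a (nondegenerate) rhombus in the Euclidean plane: it consists of four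
pairwise distinct points `a, b, c, d` such that the four sides `ab`, `bc`, `cd`, `da` of the
quadrilateral `abcd` have the same length. In the plane, distinctness of the four vertices
excludes every degenerate configuration. -/
def IsRhombus (s : Set (EuclideanSpace ℝ (Fin 2))) : Prop :=
  ∃ a b c d : EuclideanSpace ℝ (Fin 2),
    a ≠ b ∧ a ≠ c ∧ a ≠ d ∧ b ≠ c ∧ b ≠ d ∧ c ≠ d ∧
    dist a b = dist b c ∧ dist b c = dist c d ∧ dist c d = dist d a ∧
    s = {a, b, c, d}

/-- The rhombi inscribed in `γ`, each one given by its set of four vertices: all four vertices lie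
on the image of `γ`. -/
def inscribedRhombi (γ : Circle → EuclideanSpace ℝ (Fin 2)) :
    Set (Set (EuclideanSpace ℝ (Fin 2))) :=
  {s | IsRhombus s ∧ s ⊆ Set.range γ}

/-! Let `pq` be a longest chord of the curve, and take coordinates along and across it. Then `p` and
`q` are the strictly leftmost and rightmost points. The curve splits into two arcs from `p` to `q`,
and it also contains two arcs from top height to bottom height. A vertical chord joining the first
two arcs and a horizontal chord joining the other two, with a common midpoint, are the diagonals of
a rhombus. Finding them is a system of four equations in four arc parameters. Brouwer's theorem, in
complementarity form on the cube, solves it up to sign conditions on the boundary, and the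
extremality of the arc ends excludes the boundary.

By compactness the boundary stays excluded when the axes are rotated slightly
(`eventually_exists_chords_common_midpoint`), so there is a rhombus for every direction near that of
`pq`. Countably many four-point sets span only countably many directions (`countable_directions`),
hence the rhombi are uncountable. -/

open Set Metric MeasureTheory Polynomial
open scoped NNReal Topology InnerProductSpace

/-! ### Brouwer's fixed point theorem by the Milnor–Rogers volume argument -/

section Brouwer

variable {E : Type*} [NormedAddCommGroup E] [InnerProductSpace ℝ E]

/-- A map which is Lipschitz on the closed unit ball and vanishes on the sphere stays Lipschitz
when extended by zero. -/
theorem lipschitzWith_indicator_closedBall {g : E → E} {K : ℝ≥0}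
    (hg : LipschitzOnWith K g (closedBall 0 1)) (h0 : ∀ x ∈ sphere (0 : E) 1, g x = 0) :
    LipschitzWith K ((closedBall (0 : E) 1).indicator g) := by
  have key : ∀ x ∈ closedBall (0 : E) 1, ∀ y ∉ closedBall (0 : E) 1, ‖g x‖ ≤ K * ‖x - y‖ := by
    intro x hx y hy
    simp only [mem_closedBall, dist_zero_right, not_le] at hx hy
    have hc : Continuous fun t : ℝ => ‖x + t • (y - x)‖ := by fun_prop
    -- The segment from `x` to `y` crosses the sphere, where `g` vanishes; the Lipschitz bound is
    -- used only up to the crossing.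
    obtain ⟨t, ht, hz⟩ : (1 : ℝ) ∈ (fun t : ℝ => ‖x + t • (y - x)‖) '' Icc 0 1 := by
      apply intermediate_value_Icc zero_le_one hc.continuousOn
      simp only [zero_smul, add_zero, one_smul, add_sub_cancel]
      exact ⟨hx, hy.le⟩
    have hz' : ‖x + t • (y - x)‖ = 1 := hz
    have := hg.norm_sub_le (x := x) (y := x + t • (y - x)) (by simpa using hx)
      (by simp [hz'])
    rw [h0 _ (mem_sphere_zero_iff_norm.2 hz'), sub_zero] at this
    refine this.trans (mul_le_mul_of_nonneg_left ?_ K.2)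
    rw [sub_add_cancel_left, norm_neg, norm_smul, Real.norm_of_nonneg ht.1, norm_sub_rev]
    exact mul_le_of_le_one_left (norm_nonneg _) ht.2
  refine LipschitzWith.of_dist_le_mul fun x y => ?_
  rw [dist_eq_norm, dist_eq_norm]
  by_cases hx : x ∈ closedBall (0 : E) 1 <;> by_cases hy : y ∈ closedBall (0 : E) 1
  · simpa [indicator_of_mem hx, indicator_of_mem hy] using hg.norm_sub_le hx hy
  · simpa [indicator_of_mem hx, indicator_of_notMem hy] using key x hx y hy
  · simpa [indicator_of_notMem hx, indicator_of_mem hy, norm_sub_rev] using key y hy x hx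
  · simp only [indicator_of_notMem hx, indicator_of_notMem hy, sub_self, norm_zero]
    positivity

/-- A small perturbation of the identity, supported in the closed unit ball and preserving it,
is injective and maps the ball onto itself. -/
theorem injOn_image_closedBall_eq [CompleteSpace E] {f : E → E} {K : ℝ≥0} {t : ℝ}
    (hK : LipschitzOnWith K (fun x => f x - x) (closedBall 0 1))
    (h1 : ∀ x ∈ closedBall (0 : E) 1, ‖f x‖ ≤ 1) (h2 : ∀ x ∈ sphere (0 : E) 1, f x = x)
    (ht0 : 0 ≤ t) (ht1 : t ≤ 1) (htK : t * K < 1) :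
    InjOn (fun x => x + t • (f x - x)) (closedBall 0 1) ∧
      (fun x => x + t • (f x - x)) '' closedBall 0 1 = closedBall 0 1 := by
  have hL := lipschitzWith_indicator_closedBall hK (fun x hx => by simp [h2 x hx])
  set g := (closedBall (0 : E) 1).indicator (fun x => f x - x) with hg
  have hA : ApproximatesLinearOn (fun x => x + t • g x)
      ((ContinuousLinearEquiv.refl ℝ E : E ≃L[ℝ] E) : E →L[ℝ] E) univ (t.toNNReal * K) := by
    intro x _ y _
    have : x + t • g x - (y + t • g y) -
        ((ContinuousLinearEquiv.refl ℝ E : E ≃L[ℝ] E) : E →L[ℝ] E) (x - y)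
        = t • (g x - g y) := by
      simp only [ContinuousLinearEquiv.coe_refl, ContinuousLinearMap.coe_id', id_eq, smul_sub]
      abel
    rw [this, norm_smul, Real.norm_of_nonneg ht0]
    push_cast
    rw [Real.coe_toNNReal _ ht0, mul_assoc]
    exact mul_le_mul_of_nonneg_left (by simpa [dist_eq_norm] using hL.dist_le_mul x y) ht0
  have hc : Subsingleton E ∨ t.toNNReal * K <
      ‖((ContinuousLinearEquiv.refl ℝ E : E ≃L[ℝ] E).symm : E →L[ℝ] E)‖₊⁻¹ := by
    rcases subsingleton_or_nontrivial E with h | h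
    · exact Or.inl h
    · right
      have : ‖((ContinuousLinearEquiv.refl ℝ E : E ≃L[ℝ] E).symm : E →L[ℝ] E)‖₊ = 1 := by
        simp
      rw [this, inv_one, ← NNReal.coe_lt_coe]
      simpa [Real.coe_toNNReal _ ht0] using htK
  have heq : EqOn (fun x => x + t • (f x - x)) (fun x => x + t • g x) (closedBall 0 1) := by
    intro x hx
    simp [hg, indicator_of_mem hx]
  refine ⟨((hA.injOn hc).mono (subset_univ _)).congr heq.symm, ?_⟩
  apply Subset.antisymm
  · rintro _ ⟨x, hx, rfl⟩
    have hf := h1 x hx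
    simp only [mem_closedBall, dist_zero_right] at hx ⊢
    have : x + t • (f x - x) = (1 - t) • x + t • f x := by
      rw [sub_smul, one_smul, smul_sub]; abel
    rw [this]
    refine (norm_add_le _ _).trans ?_
    rw [norm_smul, norm_smul, Real.norm_of_nonneg ht0, Real.norm_of_nonneg (sub_nonneg.2 ht1)]
    nlinarith
  · intro y hy
    obtain ⟨x, rfl⟩ := hA.surjective hc y
    -- Off the ball the extended map is the identity, so a preimage of a point of the ball cannot
    -- lie outside.
    by_cases hx : x ∈ closedBall (0 : E) 1
    · exact ⟨x, hx, heq hx⟩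
    · simp only [hg, indicator_of_notMem hx, smul_zero, add_zero] at hy
      exact absurd hy hx

variable [FiniteDimensional ℝ E]

/-- The determinant of `1 + t • A` is a polynomial in `t`. -/
theorem exists_polynomial_det_one_add_smul (A : E →L[ℝ] E) :
    ∃ p : ℝ[X], p.natDegree ≤ Module.finrank ℝ E ∧
      ∀ t : ℝ, p.eval t = (1 + t • A : E →L[ℝ] E).det := by
  let b := Module.finBasis ℝ E
  let M := LinearMap.toMatrix b b (A : E →ₗ[ℝ] E)
  refine ⟨Matrix.det ((X : ℝ[X]) • M.map C + (1 : Matrix _ _ ℝ).map C), ?_, fun t => ?_⟩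
  · simpa using natDegree_det_X_add_C_le M 1
  · have h : (1 + t • A : E →L[ℝ] E).det = (1 + t • M).det := by
      rw [ContinuousLinearMap.det, ← LinearMap.det_toMatrix b]
      congr 1
      simp only [ContinuousLinearMap.toLinearMap_add, ContinuousLinearMap.toLinearMap_smul,
        map_add, map_smul, M]
      congr 1
      exact LinearMap.toMatrix_one b
    rw [h, ← coe_evalRingHom, RingHom.map_det]
    congr 1
    ext i j
    by_cases hij : i = j
    · simp [hij]; ring
    · simp [hij]; ring

/-- By the Neumann series `1 + s • A` is invertible for all `s` in `[0, t]`, so the determinant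
cannot change sign from its value 1 at `s = 0`. -/
theorem det_one_add_smul_pos {A : E →L[ℝ] E} {K t : ℝ} (hA : ‖A‖ ≤ K) (ht : 0 ≤ t)
    (htK : t * K < 1) : 0 < (1 + t • A : E →L[ℝ] E).det := by
  have hne : ∀ s ∈ Icc 0 t, (1 + s • A : E →L[ℝ] E).det ≠ 0 := by
    intro s hs h0
    have hn : ‖-(s • A)‖ < 1 := by
      rw [norm_neg, norm_smul, Real.norm_of_nonneg hs.1]
      exact (mul_le_mul hs.2 hA (norm_nonneg _) ht).trans_lt htK
    have hu := (Units.oneSub (-(s • A)) hn).isUnit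
    rw [Units.val_oneSub, sub_neg_eq_add] at hu
    have h2 := hu.map (ContinuousLinearMap.toLinearMapRingHom : (E →L[ℝ] E) →+* (E →ₗ[ℝ] E))
    have := LinearMap.isUnit_det _ h2
    exact this.ne_zero h0
  by_contra! hneg
  have hc : Continuous fun s : ℝ => (1 + s • A : E →L[ℝ] E).det :=
    ContinuousLinearMap.continuous_det.comp (by fun_prop)
  obtain ⟨s, hs, h⟩ := intermediate_value_Icc' ht hc.continuousOn
    (show (0 : ℝ) ∈ Icc _ _ from ⟨hneg, by simp [ContinuousLinearMap.det]⟩)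
  exact hne s hs h

/-- There is no continuously differentiable retraction of the closed unit ball onto its boundary. -/
theorem not_exists_contDiff_retraction {f : E → E}
    (hf : ∀ x ∈ closedBall (0 : E) 1, ContDiffAt ℝ 1 f x)
    (h1 : ∀ x ∈ closedBall (0 : E) 1, ‖f x‖ = 1) (h2 : ∀ x ∈ sphere (0 : E) 1, f x = x) :
    False := by
  borelize E
  let μ : Measure E := Measure.addHaar
  have hd : ∀ x ∈ closedBall (0 : E) 1, HasFDerivAt f (fderiv ℝ f x) x := fun x hx =>
    ((hf x hx).differentiableAt one_ne_zero).hasFDerivAt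
  have hcont : ContinuousOn (fun x => fderiv ℝ f x - 1) (closedBall 0 1) := fun x hx =>
    (((hf x hx).fderiv_right (m := 0) (by norm_num)).continuousAt.sub
      continuousAt_const).continuousWithinAt
  obtain ⟨K, hK⟩ := (isCompact_closedBall (0 : E) 1).exists_bound_of_continuousOn hcont
  have hK0 : 0 ≤ K := (norm_nonneg _).trans (hK 0 (by simp))
  lift K to ℝ≥0 using hK0
  have hL : LipschitzOnWith K (fun x => f x - x) (closedBall 0 1) :=
    (convex_closedBall (0 : E) 1).lipschitzOnWith_of_nnnorm_hasFDerivWithin_le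
      (fun x hx => ((hd x hx).sub (hasFDerivAt_id x)).hasFDerivWithinAt)
      (fun x hx => hK x hx)
  have hpos : 0 < μ.real (closedBall (0 : E) 1) :=
    ENNReal.toReal_pos (measure_closedBall_pos μ 0 one_pos).ne' measure_closedBall_lt_top.ne
  have hsmall : ∀ t : ℝ, 0 ≤ t → t ≤ 1 → t * K < 1 →
      ∫ x in closedBall (0 : E) 1, (1 + t • (fderiv ℝ f x - 1) : E →L[ℝ] E).det ∂μ
        = μ.real (closedBall (0 : E) 1) := by
    intro t ht0 ht1 htK
    obtain ⟨hinj, him⟩ := injOn_image_closedBall_eq hL (fun x hx => (h1 x hx).le) h2 ht0 ht1 htK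
    have := integral_image_eq_integral_abs_det_fderiv_smul μ (f := fun x => x + t • (f x - x))
      (f' := fun x => (1 + t • (fderiv ℝ f x - 1) : E →L[ℝ] E)) measurableSet_closedBall
      (fun x hx => ((hasFDerivAt_id x).add
        (((hd x hx).sub (hasFDerivAt_id x)).const_smul t)).hasFDerivWithinAt) hinj
      (fun _ => (1 : ℝ))
    rw [him] at this
    simp only [integral_const, smul_eq_mul, mul_one, measureReal_restrict_apply_univ] at this
    rw [this]
    refine setIntegral_congr_fun measurableSet_closedBall fun x hx => ?_
    exact (abs_of_pos (det_one_add_smul_pos (hK x hx) ht0 htK)).symm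
  have hzero : ∀ x ∈ ball (0 : E) 1, (fderiv ℝ f x).det = 0 := by
    intro x hx
    by_contra hne
    have hx' := ball_subset_closedBall hx
    -- Differentiating `‖f‖² = 1` shows that the range of the derivative is orthogonal to `f x`; an
    -- invertible derivative would have `f x` itself in its range.
    have hconst : (fun y => ⟪f y, f y⟫_ℝ) =ᶠ[𝓝 x] fun _ => 1 := by
      filter_upwards [isOpen_ball.mem_nhds hx] with y hy
      rw [real_inner_self_eq_norm_sq, h1 y (ball_subset_closedBall hy), one_pow]
    have hder := ((hd x hx').inner ℝ (hd x hx')).congr_of_eventuallyEq hconst.symm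
    have h0 := hder.unique (hasFDerivAt_const (1 : ℝ) x)
    have hsurj : Function.Surjective (fderiv ℝ f x : E →ₗ[ℝ] E) := by
      have := (LinearMap.isUnit_iff_isUnit_det _).2 (isUnit_iff_ne_zero.2 hne)
      exact ((Module.End.isUnit_iff _).1 this).2
    obtain ⟨v, hv⟩ := hsurj (f x)
    have h3 := congrArg (fun T : E →L[ℝ] ℝ => T v) h0
    have hv' : fderiv ℝ f x v = f x := hv
    simp [fderivInnerCLM_apply, hv', h1 x hx'] at h3
  -- Lagrange interpolation at `n + 1` small nodes
  let n := Module.finrank ℝ E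
  -- The factor `K + 1` makes each node at most 1 with `v i * K < 1`, as `hsmall` requires.
  let v : ℕ → ℝ := fun i => 1 / ((K + 1) * (i + 1))
  have hvi : InjOn v (Finset.range (n + 1)) := by
    intro i _ j _ hij
    have hk : (K : ℝ) + 1 ≠ 0 := by positivity
    simp only [v] at hij
    field_simp at hij
    exact_mod_cast add_right_cancel hij.symm
  have hv0 : ∀ i, 0 ≤ v i := fun i => by positivity
  have hv1 : ∀ i, v i * (K + 1) ≤ 1 := fun i => by
    have hk : (0 : ℝ) < (K : ℝ) + 1 := by positivity
    have hi : (0 : ℝ) < (i : ℝ) + 1 := by positivity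
    simp only [v]
    rw [div_mul_eq_mul_div, one_mul, div_le_one (by positivity)]
    nlinarith [mul_nonneg hk.le (Nat.cast_nonneg (α := ℝ) i)]
  let w : ℕ → ℝ := fun i => (Lagrange.basis (Finset.range (n + 1)) v i).eval 1
  have hw : ∑ i ∈ Finset.range (n + 1), w i = 1 := by
    have := congrArg (eval (1 : ℝ)) (Lagrange.sum_basis hvi (by simp))
    simpa [eval_finsetSum] using this
  -- The weights do not depend on `x` and sum to 1, so the value of the integral at small `t`
  -- carries over to `t = 1`.
  have hint : ∀ x, (fderiv ℝ f x).det =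
      ∑ i ∈ Finset.range (n + 1), w i * (1 + v i • (fderiv ℝ f x - 1) : E →L[ℝ] E).det := by
    intro x
    obtain ⟨p, hp, he⟩ := exists_polynomial_det_one_add_smul (fderiv ℝ f x - 1)
    have hp' : p.degree < (Finset.range (n + 1)).card := by
      rw [Finset.card_range]
      exact (degree_le_of_natDegree_le hp).trans_lt (by exact_mod_cast Nat.lt_succ_self n)
    have := congrArg (eval (1 : ℝ)) (Lagrange.eq_interpolate hvi hp')
    rw [he, Lagrange.interpolate_apply, eval_finsetSum, one_smul, add_sub_cancel] at this
    rw [this]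
    refine Finset.sum_congr rfl fun i _ => ?_
    rw [eval_mul, eval_C, he, mul_comm]
  have hI : ∀ i ∈ Finset.range (n + 1), IntegrableOn
      (fun x => w i * (1 + v i • (fderiv ℝ f x - 1) : E →L[ℝ] E).det) (closedBall 0 1) μ := by
    intro i _
    refine ContinuousOn.integrableOn_compact (isCompact_closedBall 0 1) ?_
    exact continuousOn_const.mul (ContinuousLinearMap.continuous_det.comp_continuousOn
      (continuousOn_const.add (by exact hcont.const_smul (v i))))
  have htot : ∫ x in closedBall (0 : E) 1, (fderiv ℝ f x).det ∂μ
      = μ.real (closedBall (0 : E) 1) := by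
    simp_rw [hint]
    rw [integral_finsetSum _ hI]
    have : ∀ i ∈ Finset.range (n + 1), ∫ x in closedBall (0 : E) 1,
        w i * (1 + v i • (fderiv ℝ f x - 1) : E →L[ℝ] E).det ∂μ
          = w i * μ.real (closedBall (0 : E) 1) := by
      intro i _
      have h3 := hv0 i
      have h4 := hv1 i
      have hk : (0 : ℝ) ≤ K := K.2
      rw [integral_const_mul, hsmall (v i) h3 (by nlinarith) ?_]
      rcases h3.eq_or_lt with h | h
      · rw [← h]; simp
      · nlinarith
    rw [Finset.sum_congr rfl this, ← Finset.sum_mul, hw, one_mul]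
  have hz : ∫ x in closedBall (0 : E) 1, (fderiv ℝ f x).det ∂μ = 0 := by
    refine integral_eq_zero_of_ae ?_
    have hs : μ (sphere (0 : E) 1) = 0 := Measure.addHaar_sphere_of_ne_zero μ 0 one_ne_zero
    filter_upwards [ae_restrict_mem measurableSet_closedBall,
      ae_restrict_of_ae (measure_eq_zero_iff_ae_notMem.1 hs)] with x hx hx'
    refine hzero x (mem_ball.2 (lt_of_le_of_ne (mem_closedBall.1 hx) hx'))
  rw [hz] at htot
  exact hpos.ne htot

/-- **Brouwer's fixed point theorem** for the closed unit ball. -/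
theorem exists_fixedPoint_closedBall {F : E → E} (hF : Continuous F)
    (h : ∀ x ∈ closedBall (0 : E) 1, ‖F x‖ ≤ 1) : ∃ x ∈ closedBall (0 : E) 1, F x = x := by
  by_contra! hne
  obtain ⟨x₀, hx₀, hmin⟩ := (isCompact_closedBall (0 : E) 1).exists_isMinOn
    ⟨0, by simp⟩ (f := fun x => ‖F x - x‖) (by fun_prop)
  set η := ‖F x₀ - x₀‖ / 4 with hη
  have hη0 : 0 < η := div_pos (norm_pos_iff.2 (sub_ne_zero.2 (hne x₀ hx₀))) four_pos
  -- Radius 2, because smoothing at a point of the unit ball involves `F` at distance up to 1 from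
  -- it.
  have huc : UniformContinuousOn F (closedBall 0 2) :=
    (isCompact_closedBall (0 : E) 2).uniformContinuousOn_of_continuous hF.continuousOn
  obtain ⟨δ, hδ, hFδ⟩ := Metric.uniformContinuousOn_iff.1 huc η hη0
  obtain ⟨H, hH, hHF⟩ := hF.exists_contDiff_dist_le_of_forall_mem_ball_dist_le
    (lt_min one_pos hδ)
  have happ : ∀ x ∈ closedBall (0 : E) 1, ‖H x - F x‖ ≤ η := by
    intro x hx
    rw [← dist_eq_norm]
    refine hHF x η fun y hy => (hFδ y ?_ x ?_ ?_).le
    · rw [mem_ball, lt_min_iff] at hy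
      rw [mem_closedBall] at hx ⊢
      linarith [dist_triangle y x 0]
    · exact closedBall_subset_closedBall one_le_two hx
    · exact (lt_min_iff.1 (mem_ball.1 hy)).2
  let G : E → E := fun x => (1 + 2 * η)⁻¹ • H x
  have hGc : ContDiff ℝ 1 G := (hH.of_le (by exact_mod_cast le_top)).const_smul _
  have hH1 : ∀ x ∈ closedBall (0 : E) 1, ‖H x‖ ≤ 1 + η := fun x hx => by
    have := norm_add_le (F x) (H x - F x)
    rw [add_sub_cancel] at this
    linarith [h x hx, happ x hx]
  have hG1 : ∀ x ∈ closedBall (0 : E) 1, ‖G x‖ < 1 := fun x hx => by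
    simp only [G]
    rw [norm_smul, Real.norm_of_nonneg (by positivity), inv_mul_lt_one₀ (by positivity)]
    linarith [hH1 x hx]
  have hGne : ∀ x ∈ closedBall (0 : E) 1, x - G x ≠ 0 := by
    intro x hx h0
    have h1 : ‖F x₀ - x₀‖ ≤ ‖F x - x‖ := hmin hx
    have hGx : G x = x := (sub_eq_zero.1 h0).symm
    -- A fixed point of `G` would move by at most `3 * η` under `F`, whereas the minimal
    -- displacement is `4 * η`.
    have h2 : F x - x = -(H x - F x) + (2 * η) • G x := by
      have h3 : (1 + 2 * η) • G x = H x := smul_inv_smul₀ (by positivity) _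
      rw [add_smul, one_smul] at h3
      rw [← h3]
      nth_rewrite 1 [hGx]
      abel
    have h4 : ‖F x - x‖ ≤ η + 2 * η * 1 := by
      rw [h2]
      refine (norm_add_le _ _).trans (add_le_add ?_ ?_)
      · rw [norm_neg]; exact happ x hx
      · rw [norm_smul, Real.norm_of_nonneg (by positivity)]
        exact mul_le_mul_of_nonneg_left (hG1 x hx).le (by positivity)
    linarith
  -- The retraction sends `x` to the point where the ray from `G x` through `x` leaves the ball: `x
  -- + s • u x` with `s` the larger root of `a s² + 2 b s + ‖x‖² - 1 = 0`, whose quarter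
  -- discriminant is `D`.
  let u : E → E := fun x => x - G x
  let b : E → ℝ := fun x => ⟪x, u x⟫_ℝ
  let a : E → ℝ := fun x => ‖u x‖ ^ 2
  let D : E → ℝ := fun x => b x ^ 2 + a x * (1 - ‖x‖ ^ 2)
  have ha : ∀ x ∈ closedBall (0 : E) 1, 0 < a x := fun x hx =>
    pow_pos (norm_pos_iff.2 (hGne x hx)) 2
  have hb : ∀ x ∈ sphere (0 : E) 1, 0 < b x := by
    intro x hx
    have hx' := sphere_subset_closedBall hx
    have hx1 := mem_sphere_zero_iff_norm.1 hx
    have := real_inner_le_norm x (G x)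
    simp only [b, u, inner_sub_right, real_inner_self_eq_norm_sq, hx1]
    rw [hx1] at this
    linarith [hG1 x hx']
  have hD : ∀ x ∈ closedBall (0 : E) 1, 0 < D x := by
    intro x hx
    rcases (mem_closedBall_zero_iff.1 hx).eq_or_lt with h1 | h1
    · have := hb x (mem_sphere_zero_iff_norm.2 h1)
      simp only [D, h1]
      positivity
    · have h2 : 0 < 1 - ‖x‖ ^ 2 := by nlinarith [norm_nonneg x]
      have := ha x hx
      have := mul_pos this h2
      simp only [D]
      positivity
  have huc1 : ContDiff ℝ 1 u := contDiff_id.sub hGc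
  have hbc : ContDiff ℝ 1 b := contDiff_id.inner ℝ huc1
  have hac : ContDiff ℝ 1 a := huc1.norm_sq ℝ
  have hDc : ContDiff ℝ 1 D :=
    (hbc.pow 2).add (hac.mul (contDiff_const.sub (contDiff_id.norm_sq ℝ)))
  refine not_exists_contDiff_retraction (f := fun x => x + ((√(D x) - b x) / a x) • u x)
    (fun x hx => ?_) (fun x hx => ?_) fun x hx => ?_
  · exact contDiffAt_id.add ((((hDc.contDiffAt.sqrt (hD x hx).ne').sub hbc.contDiffAt).div
      hac.contDiffAt (ha x hx).ne').smul huc1.contDiffAt)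
  · have h3 : ‖x + ((√(D x) - b x) / a x) • u x‖ ^ 2 = 1 := by
      rw [norm_add_sq_real, inner_smul_right, norm_smul, mul_pow, Real.norm_eq_abs, sq_abs]
      change ‖x‖ ^ 2 + 2 * ((√(D x) - b x) / a x * b x) + ((√(D x) - b x) / a x) ^ 2 * a x = 1
      have h4 := Real.sq_sqrt (hD x hx).le
      have h5 := (ha x hx).ne'
      field_simp
      have h6 : D x = b x ^ 2 + a x * (1 - ‖x‖ ^ 2) := rfl
      linear_combination h4 + h6
    exact (pow_eq_one_iff_of_nonneg (norm_nonneg _) two_ne_zero).1 h3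
  · have h3 : D x = b x ^ 2 := by
      simp [D, mem_sphere_zero_iff_norm.1 hx]
    simp [h3, Real.sqrt_sq (hb x hx).le]

/-- **Brouwer's fixed point theorem** for a bounded continuous self-map of a Euclidean space. -/
theorem exists_fixedPoint_of_bounded {F : E → E} (hF : Continuous F) {R : ℝ}
    (h : ∀ x, ‖F x‖ ≤ R) : ∃ x, F x = x := by
  have hR : 0 ≤ R := (norm_nonneg _).trans (h 0)
  have hR1 : 0 < R + 1 := by positivity
  obtain ⟨x, -, hx⟩ := exists_fixedPoint_closedBall (F := fun x => (R + 1)⁻¹ • F ((R + 1) • x))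
    (by fun_prop) fun x _ => by
      rw [norm_smul, Real.norm_of_nonneg (by positivity), inv_mul_le_one₀ hR1]
      linarith [h ((R + 1) • x)]
  refine ⟨(R + 1) • x, ?_⟩
  nth_rewrite 2 [← hx]
  rw [smul_inv_smul₀ hR1.ne']

end Brouwer

/-! ### Complementarity on a cube and chords with a common midpoint -/

/-- A continuous map on a cube has a zero for the associated complementarity problem. -/
theorem exists_complementarity_solution {ι : Type*} [Fintype ι] {Φ : (ι → ℝ) → ι → ℝ}
    (hΦ : Continuous Φ) : ∃ s : ι → ℝ, ∀ i, s i ∈ Icc (0 : ℝ) 1 ∧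
      (Φ s i < 0 → s i = 1) ∧ (0 < Φ s i → s i = 0) := by
  let pr : ℝ → ℝ := fun t => max 0 (min 1 t)
  have hpr : ∀ t, pr t ∈ Icc (0 : ℝ) 1 := fun t =>
    ⟨le_max_left _ _, max_le zero_le_one (min_le_left _ _)⟩
  have hprc : Continuous pr := by fun_prop
  -- A fixed point of the step `-Φ` followed by projection to the cube can have `Φ s i ≠ 0` only
  -- where the projection is active.
  let F : EuclideanSpace ℝ ι → EuclideanSpace ℝ ι := fun x =>
    WithLp.toLp 2 fun i => pr (x i - Φ x i)
  have hF : Continuous F := by fun_prop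
  obtain ⟨x, hx⟩ := exists_fixedPoint_of_bounded hF (R := √(Fintype.card ι)) fun x => by
    rw [EuclideanSpace.norm_eq]
    refine Real.sqrt_le_sqrt ?_
    refine (Finset.sum_le_card_nsmul _ _ 1 fun i _ => ?_).trans (by simp)
    have := hpr (x i - Φ x i)
    simp only [F, Real.norm_eq_abs, sq_abs]
    exact pow_le_one₀ this.1 this.2
  refine ⟨x, fun i => ?_⟩
  have hi : pr (x i - Φ x i) = x i := congrArg (fun y : EuclideanSpace ℝ ι => y i) hx
  have hm : x i ∈ Icc (0 : ℝ) 1 := hi ▸ hpr _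
  refine ⟨hm, fun hneg => ?_, fun hpos => ?_⟩
  · by_contra hne
    have h1 := lt_of_le_of_ne hm.2 hne
    have : x i < pr (x i - Φ x i) :=
      (lt_min h1 (by linarith)).trans_le (le_max_right _ _)
    exact this.ne hi.symm
  · by_contra hne
    have h1 := lt_of_le_of_ne hm.1 (Ne.symm hne)
    have : pr (x i - Φ x i) < x i := max_lt h1 ((min_le_right _ _).trans_lt (by linarith))
    exact this.ne hi

/-- Four paths such that `α`, `κ` run from the leftmost point `p` to the rightmost point `q`, while
`β`, `δ` run from the top to the bottom: for every small rotation (with parameter `τ`) of the axes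
there are a vertical chord from `α` to `κ` and a horizontal chord from `β` to `δ` with the same
midpoint, and with ends in the interior of the paths. -/
theorem eventually_exists_chords_common_midpoint {P : Type*} [TopologicalSpace P] {x y : P → ℝ}
    (hx : Continuous x) (hy : Continuous y) (hxy : ∀ a b, x a = x b → y a = y b → a = b)
    {α κ β δ : ℝ → P} (hα : Continuous α) (hκ : Continuous κ) (hβ : Continuous β)
    (hδ : Continuous δ) {p q : P} {top bot : ℝ}
    (hα0 : α 0 = p) (hκ0 : κ 0 = p) (hα1 : α 1 = q) (hκ1 : κ 1 = q)
    (hβ0 : y (β 0) = top) (hδ0 : y (δ 0) = top) (hβ1 : y (β 1) = bot) (hδ1 : y (δ 1) = bot)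
    (hβp : ∀ s ∈ Icc (0 : ℝ) 1, x p ≤ x (β s) ∧ x (β s) ≤ x q)
    (hδp : ∀ s ∈ Icc (0 : ℝ) 1, x p ≤ x (δ s) ∧ x (δ s) ≤ x q)
    (hαy : ∀ s ∈ Icc (0 : ℝ) 1, bot ≤ y (α s) ∧ y (α s) ≤ top)
    (hκy : ∀ s ∈ Icc (0 : ℝ) 1, bot ≤ y (κ s) ∧ y (κ s) ≤ top)
    (hακ : ∀ s ∈ Icc (0 : ℝ) 1, ∀ t ∈ Icc (0 : ℝ) 1, α s = κ t → α s = p ∨ α s = q)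
    (hβδp : ∀ s ∈ Icc (0 : ℝ) 1, ∀ t ∈ Icc (0 : ℝ) 1, ¬ (x (β s) = x p ∧ x (δ t) = x p))
    (hβδq : ∀ s ∈ Icc (0 : ℝ) 1, ∀ t ∈ Icc (0 : ℝ) 1, ¬ (x (β s) = x q ∧ x (δ t) = x q)) :
    ∀ᶠ τ in 𝓝 (0 : ℝ), ∃ a ∈ Ioo (0 : ℝ) 1, ∃ c ∈ Ioo (0 : ℝ) 1, ∃ b ∈ Ioo (0 : ℝ) 1,
      ∃ d ∈ Ioo (0 : ℝ) 1,
        x (α a) + τ * y (α a) = x (κ c) + τ * y (κ c) ∧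
        y (β b) - τ * x (β b) = y (δ d) - τ * x (δ d) ∧
        x (α a) + τ * y (α a) + (x (κ c) + τ * y (κ c))
          = x (β b) + τ * y (β b) + (x (δ d) + τ * y (δ d)) ∧
        y (α a) - τ * x (α a) + (y (κ c) - τ * x (κ c))
          = y (β b) - τ * x (β b) + (y (δ d) - τ * x (δ d)) := by
  let X : ℝ → P → ℝ := fun τ z => x z + τ * y z
  let Y : ℝ → P → ℝ := fun τ z => y z - τ * x z
  -- The parameters belong to `α`, `κ`, `β`, `δ` in this order. The last two signs are reversed
  -- because `β` and `δ` run downwards.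
  let Φ : ℝ → (Fin 4 → ℝ) → Fin 4 → ℝ := fun τ s =>
    ![X τ (α (s 0)) - (X τ (β (s 2)) + X τ (δ (s 3))) / 2,
      X τ (κ (s 1)) - (X τ (β (s 2)) + X τ (δ (s 3))) / 2,
      (Y τ (α (s 0)) + Y τ (κ (s 1))) / 2 - Y τ (β (s 2)),
      (Y τ (α (s 0)) + Y τ (κ (s 1))) / 2 - Y τ (δ (s 3))]
  have hΦ : ∀ i, Continuous fun z : ℝ × (Fin 4 → ℝ) => Φ z.1 z.2 i := by
    intro i
    fin_cases i <;> simp only [Φ, X, Y] <;> simp <;> fun_prop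
  let Q : ℝ → (Fin 4 → ℝ) → Prop := fun τ s =>
    ∀ i, (Φ τ s i < 0 → s i = 1) ∧ (0 < Φ τ s i → s i = 0)
  let K : Set (Fin 4 → ℝ) := Set.pi univ fun _ => Icc (0 : ℝ) 1
  have hK : IsCompact K := isCompact_univ_pi fun _ => isCompact_Icc
  have hzero : ∀ s ∈ K, Q 0 s → ∀ i, s i ∈ Ioo (0 : ℝ) 1 := by
    intro s hs hQ
    have hI : ∀ i, s i ∈ Icc (0 : ℝ) 1 := fun i => hs i (mem_univ i)
    have b1 := hβp _ (hI 2)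
    have b2 := hδp _ (hI 3)
    have b3 := hαy _ (hI 0)
    have b4 := hκy _ (hI 1)
    have q0 := hQ 0
    have q1 := hQ 1
    have q2 := hQ 2
    have q3 := hQ 3
    simp only [Φ, X, Y, Matrix.cons_val, zero_mul, add_zero, sub_zero] at q0 q1 q2 q3
    -- A nonzero sign would put the parameter at the end of its path where the extremal coordinate
    -- contradicts that sign; likewise for `e1`, `e2`, `e3`.
    have e0 : x (α (s 0)) = (x (β (s 2)) + x (δ (s 3))) / 2 := by
      rcases lt_trichotomy (x (α (s 0)) - (x (β (s 2)) + x (δ (s 3))) / 2) 0 with h | h | h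
      · rw [q0.1 h, hα1] at h; linarith
      · linarith
      · rw [q0.2 h, hα0] at h; linarith
    have e1 : x (κ (s 1)) = (x (β (s 2)) + x (δ (s 3))) / 2 := by
      rcases lt_trichotomy (x (κ (s 1)) - (x (β (s 2)) + x (δ (s 3))) / 2) 0 with h | h | h
      · rw [q1.1 h, hκ1] at h; linarith
      · linarith
      · rw [q1.2 h, hκ0] at h; linarith
    have e2 : y (β (s 2)) = (y (α (s 0)) + y (κ (s 1))) / 2 := by
      rcases lt_trichotomy ((y (α (s 0)) + y (κ (s 1))) / 2 - y (β (s 2))) 0 with h | h | h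
      · rw [q2.1 h, hβ1] at h; linarith
      · linarith
      · rw [q2.2 h, hβ0] at h; linarith
    have e3 : y (δ (s 3)) = (y (α (s 0)) + y (κ (s 1))) / 2 := by
      rcases lt_trichotomy ((y (α (s 0)) + y (κ (s 1))) / 2 - y (δ (s 3))) 0 with h | h | h
      · rw [q3.1 h, hδ1] at h; linarith
      · linarith
      · rw [q3.2 h, hδ0] at h; linarith
    have np : (x (β (s 2)) + x (δ (s 3))) / 2 ≠ x p := fun h =>
      hβδp _ (hI 2) _ (hI 3) ⟨by linarith, by linarith⟩
    have nq : (x (β (s 2)) + x (δ (s 3))) / 2 ≠ x q := fun h =>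
      hβδq _ (hI 2) _ (hI 3) ⟨by linarith, by linarith⟩
    have nac : y (α (s 0)) ≠ y (κ (s 1)) := by
      intro h
      rcases hακ _ (hI 0) _ (hI 1) (hxy _ _ (e0.trans e1.symm) h) with h | h
      · exact np (by rw [← e0, h])
      · exact nq (by rw [← e0, h])
    -- A mean equal to the extreme height forces both heights to be extreme, hence equal.
    have ntop : (y (α (s 0)) + y (κ (s 1))) / 2 ≠ top := fun h =>
      nac (by linarith)
    have nbot : (y (α (s 0)) + y (κ (s 1))) / 2 ≠ bot := fun h =>
      nac (by linarith)
    have key : ∀ i, s i ≠ 0 ∧ s i ≠ 1 := by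
      rw [Fin.forall_fin_succ, Fin.forall_fin_succ, Fin.forall_fin_succ, Fin.forall_fin_one]
      refine ⟨⟨fun h => ?_, fun h => ?_⟩, ⟨fun h => ?_, fun h => ?_⟩, ⟨fun h => ?_, fun h => ?_⟩,
        ⟨fun h => ?_, fun h => ?_⟩⟩
      · rw [h, hα0] at e0; exact np e0.symm
      · rw [h, hα1] at e0; exact nq e0.symm
      · exact np (by rw [← e1, ← hκ0, ← h]; rfl)
      · exact nq (by rw [← e1, ← hκ1, ← h]; rfl)
      · exact ntop (by rw [← e2, ← hβ0, ← h]; rfl)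
      · exact nbot (by rw [← e2, ← hβ1, ← h]; rfl)
      · exact ntop (by rw [← e3, ← hδ0, ← h]; rfl)
      · exact nbot (by rw [← e3, ← hδ1, ← h]; rfl)
    exact fun i => ⟨lt_of_le_of_ne (hI i).1 (key i).1.symm, lt_of_le_of_ne (hI i).2 (key i).2⟩
  -- Violating `Q` is an open condition on `(τ, s)`, and so is lying in the open cube; compactness
  -- of `K` gives one neighbourhood of `τ = 0`.
  have hev : ∀ᶠ τ in 𝓝 (0 : ℝ), ∀ s ∈ K, Q τ s → ∀ i, s i ∈ Ioo (0 : ℝ) 1 := by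
    refine hK.eventually_forall_of_forall_eventually fun s hs => ?_
    by_cases hQ : Q 0 s
    · have ho : IsOpen {z : ℝ × (Fin 4 → ℝ) | ∀ i, z.2 i ∈ Ioo (0 : ℝ) 1} := by
        simp only [ofPred_forall]
        exact isOpen_iInter_of_finite fun i => isOpen_Ioo.preimage (by fun_prop)
      filter_upwards [ho.mem_nhds (show ((0 : ℝ), s) ∈ _ from hzero s hs hQ)] with z hz _
      exact hz
    · obtain ⟨i, hi⟩ := not_forall.1 hQ
      have hs' : Continuous fun z : ℝ × (Fin 4 → ℝ) => z.2 i := by fun_prop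
      rcases not_and_or.1 hi with h | h
      · obtain ⟨h1, h2⟩ := Classical.not_imp.1 h
        filter_upwards [((isOpen_lt (hΦ i) continuous_const).inter
          (isOpen_ne_fun hs' continuous_const)).mem_nhds
            (show ((0 : ℝ), s) ∈ _ from ⟨h1, h2⟩)] with z hz hQz
        exact absurd ((hQz i).1 hz.1) hz.2
      · obtain ⟨h1, h2⟩ := Classical.not_imp.1 h
        filter_upwards [((isOpen_lt continuous_const (hΦ i)).inter
          (isOpen_ne_fun hs' continuous_const)).mem_nhds
            (show ((0 : ℝ), s) ∈ _ from ⟨h1, h2⟩)] with z hz hQz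
        exact absurd ((hQz i).2 hz.1) hz.2
  filter_upwards [hev] with τ hτ
  obtain ⟨s, hs⟩ := exists_complementarity_solution (Φ := Φ τ)
    (continuous_pi fun i => (hΦ i).comp (Continuous.prodMk_right τ))
  have hI := hτ s (fun i _ => (hs i).1) fun i => (hs i).2
  have hz : ∀ i, Φ τ s i = 0 := by
    intro i
    rcases lt_trichotomy (Φ τ s i) 0 with h | h | h
    · exact absurd ((hs i).2.1 h) (hI i).2.ne
    · exact h
    · exact absurd ((hs i).2.2 h) (hI i).1.ne'
  have z0 := hz 0
  have z1 := hz 1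
  have z2 := hz 2
  have z3 := hz 3
  simp only [Φ, X, Y, Matrix.cons_val] at z0 z1 z2 z3
  exact ⟨s 0, hI 0, s 1, hI 1, s 2, hI 2, s 3, hI 3, by linarith, by linarith, by linarith,
    by linarith⟩

/-! ### Rhombi from their diagonals -/

theorem euclidean_ext (v w : EuclideanSpace ℝ (Fin 2)) (h0 : v 0 = w 0) (h1 : v 1 = w 1) :
    v = w := by
  ext i
  fin_cases i
  · exact h0
  · exact h1

/-- A quadrilateral whose diagonals are orthogonal and bisect each other is a rhombus. -/
theorem isRhombus_of_diagonals {a b c d : EuclideanSpace ℝ (Fin 2)} {m n : ℝ}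
    (hmn : m ≠ 0 ∨ n ≠ 0) (hac : a ≠ c) (hbd : b ≠ d)
    (h1 : m * a 0 + n * a 1 = m * c 0 + n * c 1)
    (h2 : m * b 1 - n * b 0 = m * d 1 - n * d 0)
    (h3 : m * a 0 + n * a 1 + (m * c 0 + n * c 1) = m * b 0 + n * b 1 + (m * d 0 + n * d 1))
    (h4 : m * a 1 - n * a 0 + (m * c 1 - n * c 0) = m * b 1 - n * b 0 + (m * d 1 - n * d 0)) :
    IsRhombus {a, b, c, d} := by
  have hN : m ^ 2 + n ^ 2 ≠ 0 := by
    rcases hmn with h | h <;> positivity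
  have e0 : a 0 + c 0 = b 0 + d 0 := mul_left_cancel₀ hN (by linear_combination m * h3 - n * h4)
  have e1 : a 1 + c 1 = b 1 + d 1 := mul_left_cancel₀ hN (by linear_combination n * h3 + m * h4)
  have ho : (a 0 - c 0) * (b 0 - d 0) + (a 1 - c 1) * (b 1 - d 1) = 0 :=
    mul_left_cancel₀ hN (by
      linear_combination (m * (b 0 - d 0) + n * (b 1 - d 1)) * h1
        + (m * (a 1 - c 1) - n * (a 0 - c 0)) * h2)
  have hA : (a 0 - c 0) ^ 2 + (a 1 - c 1) ^ 2 ≠ 0 := fun h => hac (euclidean_ext _ _ (by nlinarith)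
    (by nlinarith))
  refine ⟨a, b, c, d, ?_, hac, ?_, ?_, hbd, ?_, ?_, ?_, ?_, rfl⟩
  -- If adjacent vertices coincide, the common midpoint makes the diagonals equal up to sign, and
  -- orthogonality then kills them.
  · rintro rfl
    exact hA (by linear_combination ho - (a 0 - c 0) * e0 - (a 1 - c 1) * e1)
  · rintro rfl
    exact hA (by linear_combination -ho - (a 0 - c 0) * e0 - (a 1 - c 1) * e1)
  · rintro rfl
    exact hA (by linear_combination -ho + (a 0 - b 0) * e0 + (a 1 - b 1) * e1)
  · rintro rfl
    exact hA (by linear_combination ho + (a 0 - c 0) * e0 + (a 1 - c 1) * e1)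
  all_goals
    simp only [EuclideanSpace.dist_eq, Fin.sum_univ_two, Real.dist_eq, sq_abs]
    congr 1
  · linear_combination -ho + (a 0 - c 0) * e0 + (a 1 - c 1) * e1
  · linear_combination ho - (b 0 - d 0) * e0 - (b 1 - d 1) * e1
  · linear_combination -ho - (a 0 - c 0) * e0 - (a 1 - c 1) * e1

/-! ### Arcs of a simple closed curve -/

/-- Two consecutive arcs of a simple closed curve meet only at common endpoints. -/
theorem eq_of_apply_eq_of_consecutive {V : Type*} {f : ℝ → V} {T lo w hi r r' : ℝ}
    (hinj : ∀ s t, f s = f t → |s - t| < T → s = t) (hT : hi ≤ lo + T)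
    (hr : r ∈ Icc lo w) (hr' : r' ∈ Icc w hi) (h : f r = f r') :
    (r = w ∧ r' = w) ∨ (r = lo ∧ r' = hi ∧ hi = lo + T) := by
  rcases lt_or_ge (r' - r) T with hlt | hge
  · left
    have := hinj r' r h.symm (by rw [abs_of_nonneg (by linarith [hr.2, hr'.1])]; exact hlt)
    constructor <;> linarith [hr.2, hr'.1]
  · right
    refine ⟨?_, ?_, ?_⟩ <;> linarith [hr.1, hr'.2]

theorem lineMap_mem_Icc {u v s : ℝ} (huv : u ≤ v) (hs : s ∈ Icc (0 : ℝ) 1) :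
    AffineMap.lineMap u v s ∈ Icc u v ∧ AffineMap.lineMap v u s ∈ Icc u v := by
  simp only [AffineMap.lineMap_apply_ring', mem_Icc]
  have h1 := mul_nonneg hs.1 (sub_nonneg.2 huv)
  have h2 := mul_nonneg (sub_nonneg.2 hs.2) (sub_nonneg.2 huv)
  refine ⟨⟨?_, ?_⟩, ?_, ?_⟩ <;> nlinarith

theorem lineMap_mem_Ioo {u v s : ℝ} (huv : u < v) (hs : s ∈ Ioo (0 : ℝ) 1) :
    AffineMap.lineMap u v s ∈ Ioo u v ∧ AffineMap.lineMap v u s ∈ Ioo u v := by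
  simp only [AffineMap.lineMap_apply_ring', mem_Ioo]
  have h1 := mul_pos hs.1 (sub_pos.2 huv)
  have h2 := mul_pos (sub_pos.2 hs.2) (sub_pos.2 huv)
  refine ⟨⟨?_, ?_⟩, ?_, ?_⟩ <;> nlinarith

/-- On a simple closed curve with strictly leftmost point `f θ₀` and strictly rightmost point
`f θ₁`, two arcs from the top to the bottom provide, for every small rotation of the axes, a
vertical and a horizontal nondegenerate chord with the same midpoint. -/
theorem eventually_exists_orthogonal_chords {V : Type*} [TopologicalSpace V] {x y : V → ℝ}
    (hx : Continuous x) (hy : Continuous y) (hxy : ∀ a b, x a = x b → y a = y b → a = b)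
    {f : ℝ → V} (hf : Continuous f) {T θ₀ θ₁ lo w hi : ℝ}
    (hper : ∀ s, f (s + T) = f s) (hinj : ∀ s t, f s = f t → |s - t| < T → s = t)
    (h01 : θ₀ < θ₁) (h10 : θ₁ < θ₀ + T)
    (hx0 : ∀ s, x (f θ₀) ≤ x (f s)) (hx1 : ∀ s, x (f s) ≤ x (f θ₁))
    (hx0' : ∀ s, x (f s) = x (f θ₀) → f s = f θ₀) (hx1' : ∀ s, x (f s) = x (f θ₁) → f s = f θ₁)
    (hlo : lo < w) (hhi : w < hi) (hT : hi ≤ lo + T)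
    (htop : ∀ s, y (f s) ≤ y (f lo)) (htop' : y (f hi) = y (f lo)) (hbot : ∀ s, y (f w) ≤ y (f s))
    (hw0 : f w ≠ f θ₀) (hw1 : f w ≠ f θ₁)
    (hl : hi = lo + T → f lo ≠ f θ₀ ∧ f lo ≠ f θ₁) :
    ∀ᶠ τ in 𝓝 (0 : ℝ), ∃ a ∈ range f, ∃ c ∈ range f, ∃ b ∈ range f, ∃ d ∈ range f,
      a ≠ c ∧ b ≠ d ∧
        x a + τ * y a = x c + τ * y c ∧ y b - τ * x b = y d - τ * x d ∧
        x a + τ * y a + (x c + τ * y c) = x b + τ * y b + (x d + τ * y d) ∧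
        y a - τ * x a + (y c - τ * x c) = y b - τ * x b + (y d - τ * x d) := by
  have hend : ∀ s ∈ Icc (0 : ℝ) 1, ∀ t ∈ Icc (0 : ℝ) 1,
      f (AffineMap.lineMap lo w s) = f (AffineMap.lineMap hi w t) →
      f (AffineMap.lineMap lo w s) ≠ f θ₀ ∧ f (AffineMap.lineMap lo w s) ≠ f θ₁ := by
    intro s hs t ht h
    rcases eq_of_apply_eq_of_consecutive hinj hT (lineMap_mem_Icc hlo.le hs).1
      (lineMap_mem_Icc hhi.le ht).2 h with h | h
    · rw [h.1]; exact ⟨hw0, hw1⟩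
    · rw [h.1]; exact hl h.2.2
  -- `κ` and `δ` run backwards, from `θ₀ + T` to `θ₁` and from `hi` to `w`, so that each pair of
  -- arcs starts and ends on matching extremes.
  have := eventually_exists_chords_common_midpoint hx hy hxy
    (α := fun s => f (AffineMap.lineMap θ₀ θ₁ s)) (κ := fun s => f (AffineMap.lineMap (θ₀ + T) θ₁ s))
    (β := fun s => f (AffineMap.lineMap lo w s)) (δ := fun s => f (AffineMap.lineMap hi w s))
    (p := f θ₀) (q := f θ₁) (top := y (f lo)) (bot := y (f w))
    (by fun_prop) (by fun_prop) (by fun_prop) (by fun_prop)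
    (by simp) (by simp [hper]) (by simp) (by simp) (by simp) (by simpa using htop')
    (by simp) (by simp) (fun s _ => ⟨hx0 _, hx1 _⟩) (fun s _ => ⟨hx0 _, hx1 _⟩)
    (fun s _ => ⟨hbot _, htop _⟩) (fun s _ => ⟨hbot _, htop _⟩)
    (fun s hs t ht h => by
      rcases eq_of_apply_eq_of_consecutive hinj le_rfl (lineMap_mem_Icc h01.le hs).1
        (lineMap_mem_Icc h10.le ht).2 h with h | h
      · right; rw [h.1]
      · left; rw [h.1])
    (fun s hs t ht h => by
      have e1 := hx0' _ h.1
      exact (hend s hs t ht (e1.trans (hx0' _ h.2).symm)).1 e1)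
    (fun s hs t ht h => by
      have e1 := hx1' _ h.1
      exact (hend s hs t ht (e1.trans (hx1' _ h.2).symm)).2 e1)
  filter_upwards [this] with τ hτ
  obtain ⟨a, ha, c, hc, b, hb, d, hd, h⟩ := hτ
  refine ⟨_, mem_range_self _, _, mem_range_self _, _, mem_range_self _, _, mem_range_self _,
    fun hac => ?_, fun hbd => ?_, h⟩
  · have m1 := (lineMap_mem_Ioo h01 ha).1
    have m2 := (lineMap_mem_Ioo h10 hc).2
    rcases eq_of_apply_eq_of_consecutive hinj le_rfl (Ioo_subset_Icc_self m1)
      (Ioo_subset_Icc_self m2) hac with h | h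
    · exact m1.2.ne h.1
    · exact m1.1.ne' h.1
  · have m1 := (lineMap_mem_Ioo hlo hb).1
    have m2 := (lineMap_mem_Ioo hhi hd).2
    rcases eq_of_apply_eq_of_consecutive hinj hT (Ioo_subset_Icc_self m1)
      (Ioo_subset_Icc_self m2) hbd with h | h
    · exact m1.2.ne h.1
    · exact m1.1.ne' h.1

/-! ### Coordinates adapted to a diameter -/

/-- The coordinate along the vector `u`. -/
def alongCoord (u z : EuclideanSpace ℝ (Fin 2)) : ℝ := u 0 * z 0 + u 1 * z 1

/-- The coordinate across the vector `u`. -/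
def acrossCoord (u z : EuclideanSpace ℝ (Fin 2)) : ℝ := u 0 * z 1 - u 1 * z 0

theorem continuous_alongCoord (u : EuclideanSpace ℝ (Fin 2)) : Continuous (alongCoord u) := by
  unfold alongCoord; fun_prop

theorem continuous_acrossCoord (u : EuclideanSpace ℝ (Fin 2)) : Continuous (acrossCoord u) := by
  unfold acrossCoord; fun_prop

theorem sq_add_sq_pos_of_ne_zero {u : EuclideanSpace ℝ (Fin 2)} (hu : u ≠ 0) :
    0 < u 0 ^ 2 + u 1 ^ 2 := by
  have := EuclideanSpace.real_norm_sq_eq u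
  rw [Fin.sum_univ_two] at this
  rw [← this]
  exact pow_pos (norm_pos_iff.2 hu) 2

theorem eq_of_coord_eq {u : EuclideanSpace ℝ (Fin 2)} (hu : u ≠ 0)
    (a b : EuclideanSpace ℝ (Fin 2)) (h1 : alongCoord u a = alongCoord u b)
    (h2 : acrossCoord u a = acrossCoord u b) : a = b := by
  have hN := (sq_add_sq_pos_of_ne_zero hu).ne'
  simp only [alongCoord, acrossCoord] at h1 h2
  refine euclidean_ext _ _ ?_ ?_
  · exact mul_left_cancel₀ hN (by linear_combination u 0 * h1 - u 1 * h2)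
  · exact mul_left_cancel₀ hN (by linear_combination u 1 * h1 + u 0 * h2)

/-- A closed half plane bounded by the perpendicular to `p q` at `p` contains every point whose
distance to `q` is at most the distance from `p` to `q`. -/
theorem alongCoord_le_of_dist_le {p q z : EuclideanSpace ℝ (Fin 2)} (h : dist z q ≤ dist p q) :
    alongCoord (q - p) p ≤ alongCoord (q - p) z ∧
      (alongCoord (q - p) z = alongCoord (q - p) p → z = p) := by
  have h2 : dist z q ^ 2 ≤ dist p q ^ 2 := pow_le_pow_left₀ dist_nonneg h 2
  rw [EuclideanSpace.dist_sq_eq, EuclideanSpace.dist_sq_eq] at h2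
  simp only [Fin.sum_univ_two, Real.dist_eq, sq_abs] at h2
  simp only [alongCoord, PiLp.sub_apply]
  -- Expanding about `p`, the hypothesis says `‖z - p‖² ≤ 2 ⟪z - p, q - p⟫`.
  refine ⟨by nlinarith [sq_nonneg (z 0 - p 0), sq_nonneg (z 1 - p 1)], fun he => ?_⟩
  have h3 : (z 0 - p 0) ^ 2 + (z 1 - p 1) ^ 2 ≤ 0 := by nlinarith
  refine euclidean_ext _ _ ?_ ?_
  · nlinarith [sq_nonneg (z 0 - p 0), sq_nonneg (z 1 - p 1)]
  · nlinarith [sq_nonneg (z 0 - p 0), sq_nonneg (z 1 - p 1)]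

/-! ### Closed curves and their diameters -/

section ClosedCurve

variable {f : ℝ → EuclideanSpace ℝ (Fin 2)} {T : ℝ} {p q : EuclideanSpace ℝ (Fin 2)}

theorem exists_mem_Ico_apply_eq {V : Type*} {f : ℝ → V} {T : ℝ} (hT : 0 < T)
    (hper : Function.Periodic f T) (a : ℝ) {z : V} (hz : z ∈ range f) :
    ∃ s ∈ Ico a (a + T), f s = z := by
  obtain ⟨s, rfl⟩ := hz
  obtain ⟨t, ht, h⟩ := hper.exists_mem_Ico hT s a
  exact ⟨t, ht, h.symm⟩

theorem acrossCoord_sub_left (p q : EuclideanSpace ℝ (Fin 2)) :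
    acrossCoord (q - p) q = acrossCoord (q - p) p := by
  simp only [acrossCoord, PiLp.sub_apply]; ring

theorem acrossCoord_swap (p q z : EuclideanSpace ℝ (Fin 2)) :
    acrossCoord (p - q) z = -acrossCoord (q - p) z := by
  simp only [acrossCoord, PiLp.sub_apply]; ring

theorem alongCoord_swap (p q z : EuclideanSpace ℝ (Fin 2)) :
    alongCoord (p - q) z = -alongCoord (q - p) z := by
  simp only [alongCoord, PiLp.sub_apply]; ring

theorem alongCoord_lt (h : p ≠ q) : alongCoord (q - p) p < alongCoord (q - p) q := by
  have := sq_add_sq_pos_of_ne_zero (sub_ne_zero.2 h.symm)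
  simp only [PiLp.sub_apply] at this
  simp only [alongCoord, PiLp.sub_apply]
  linarith

/-- Both ends of a diameter are strict extremes of the coordinate along it. -/
theorem alongCoord_of_diameter (hdiam : ∀ z ∈ range f, ∀ z' ∈ range f, dist z z' ≤ dist p q)
    (hp : p ∈ range f) (hq : q ∈ range f) (s : ℝ) :
    (alongCoord (q - p) p ≤ alongCoord (q - p) (f s) ∧
      alongCoord (q - p) (f s) ≤ alongCoord (q - p) q) ∧
      (alongCoord (q - p) (f s) = alongCoord (q - p) p → f s = p) ∧
      (alongCoord (q - p) (f s) = alongCoord (q - p) q → f s = q) := by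
  have h1 := alongCoord_le_of_dist_le (hdiam (f s) (mem_range_self s) q hq)
  have h2 := alongCoord_le_of_dist_le (p := q) (q := p) (z := f s)
    ((hdiam (f s) (mem_range_self s) p hp).trans_eq (dist_comm p q))
  rw [alongCoord_swap p q, alongCoord_swap p q, neg_le_neg_iff, neg_inj] at h2
  exact ⟨⟨h1.1, h2.1⟩, h1.2, h2.2⟩

/-- A simple closed curve is not contained in a line. -/
theorem exists_acrossCoord_ne (hf : Continuous f) (hT : 0 < T) (hper : Function.Periodic f T)
    (hinj : ∀ s t, f s = f t → |s - t| < T → s = t) (hp : p ∈ range f) (hq : q ∈ range f)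
    (hpq : p ≠ q) : ∃ s, acrossCoord (q - p) (f s) ≠ acrossCoord (q - p) p := by
  by_contra! hline
  obtain ⟨θ₀, rfl⟩ := hp
  obtain ⟨θ₁, h1, rfl⟩ := exists_mem_Ico_apply_eq hT hper θ₀ hq
  have h01 : θ₀ < θ₁ := lt_of_le_of_ne h1.1 fun h => hpq (by rw [h])
  have hlt := alongCoord_lt hpq
  set x := alongCoord (f θ₁ - f θ₀)
  have hxf : Continuous fun s => x (f s) := (continuous_alongCoord _).comp hf
  -- On a line, both arcs from `p` to `q` would pass through the same midpoint at interior
  -- parameters.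
  obtain ⟨r, hr, hrx⟩ := intermediate_value_Ioo h01.le hxf.continuousOn
    (show (x (f θ₀) + x (f θ₁)) / 2 ∈ Ioo _ _ from ⟨by linarith, by linarith⟩)
  obtain ⟨r', hr', hrx'⟩ := intermediate_value_Ioo' h1.2.le hxf.continuousOn
    (show (x (f θ₀) + x (f θ₁)) / 2 ∈ Ioo _ _ from
      ⟨by rw [hper]; linarith, by linarith⟩)
  have heq : f r = f r' := eq_of_coord_eq (sub_ne_zero.2 hpq.symm) _ _ (hrx.trans hrx'.symm)
    ((hline r).trans (hline r').symm)
  rcases eq_of_apply_eq_of_consecutive hinj le_rfl (Ioo_subset_Icc_self hr)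
    (Ioo_subset_Icc_self hr') heq with h | h
  · exact hr.2.ne h.1
  · exact hr.1.ne' h.1

/-- If a diameter of a simple closed curve is not below the whole curve, then the curve
inscribes pairs of orthogonal chords with a common midpoint in all directions close to that of
the diameter. -/
theorem eventually_exists_orthogonal_chords_of_diameter (hf : Continuous f) (hT : 0 < T)
    (hper : Function.Periodic f T) (hinj : ∀ s t, f s = f t → |s - t| < T → s = t)
    (hp : p ∈ range f) (hq : q ∈ range f) (hpq : p ≠ q)
    (hdiam : ∀ z ∈ range f, ∀ z' ∈ range f, dist z z' ≤ dist p q)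
    (hbelow : ∃ s, acrossCoord (q - p) (f s) < acrossCoord (q - p) p) :
    ∀ᶠ τ in 𝓝 (0 : ℝ), ∃ a ∈ range f, ∃ c ∈ range f, ∃ b ∈ range f, ∃ d ∈ range f,
      a ≠ c ∧ b ≠ d ∧
        alongCoord (q - p) a + τ * acrossCoord (q - p) a
          = alongCoord (q - p) c + τ * acrossCoord (q - p) c ∧
        acrossCoord (q - p) b - τ * alongCoord (q - p) b
          = acrossCoord (q - p) d - τ * alongCoord (q - p) d ∧
        alongCoord (q - p) a + τ * acrossCoord (q - p) a
            + (alongCoord (q - p) c + τ * acrossCoord (q - p) c)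
          = alongCoord (q - p) b + τ * acrossCoord (q - p) b
            + (alongCoord (q - p) d + τ * acrossCoord (q - p) d) ∧
        acrossCoord (q - p) a - τ * alongCoord (q - p) a
            + (acrossCoord (q - p) c - τ * alongCoord (q - p) c)
          = acrossCoord (q - p) b - τ * alongCoord (q - p) b
            + (acrossCoord (q - p) d - τ * alongCoord (q - p) d) := by
  have hu : q - p ≠ 0 := sub_ne_zero.2 hpq.symm
  have hx := alongCoord_of_diameter hdiam hp hq
  have hpq' := acrossCoord_sub_left p q
  have hyc := continuous_acrossCoord (q - p)
  have hyf : Continuous fun s => acrossCoord (q - p) (f s) := hyc.comp hf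
  have hcomp : ∀ g : EuclideanSpace ℝ (Fin 2) → ℝ, Continuous g →
      ∃ s, ∀ t, g (f t) ≤ g (f s) := by
    intro g hg
    obtain ⟨s, -, hs⟩ := (isCompact_Icc (a := (0 : ℝ)) (b := T)).exists_isMaxOn
      ⟨0, by simp [hT.le]⟩ (hg.comp hf).continuousOn
    refine ⟨s, fun t => ?_⟩
    obtain ⟨t', ht', h⟩ := exists_mem_Ico_apply_eq hT hper 0 (mem_range_self t)
    rw [zero_add] at ht'
    rw [← h]
    exact hs (Ico_subset_Icc_self ht')
  obtain ⟨σ, hσ⟩ := hcomp _ hyc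
  obtain ⟨ρ, hρ⟩ := hcomp _ hyc.neg
  replace hρ : ∀ t, acrossCoord (q - p) (f ρ) ≤ acrossCoord (q - p) (f t) := fun t =>
    neg_le_neg_iff.1 (hρ t)
  have hρp : acrossCoord (q - p) (f ρ) < acrossCoord (q - p) p := by
    obtain ⟨s, hs⟩ := hbelow
    exact (hρ s).trans_lt hs
  have hρ0 : f ρ ≠ p := fun h => hρp.ne (by rw [h])
  have hρ1 : f ρ ≠ q := fun h => hρp.ne (by rw [h, hpq'])
  obtain ⟨θ₀, rfl⟩ := hp
  obtain ⟨θ₁, h1, rfl⟩ := exists_mem_Ico_apply_eq hT hper θ₀ hq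
  have h01 : θ₀ < θ₁ := lt_of_le_of_ne h1.1 fun h => hpq (by rw [h])
  have main := fun lo w hi => eventually_exists_orthogonal_chords (lo := lo) (w := w) (hi := hi)
    (continuous_alongCoord (f θ₁ - f θ₀)) hyc (eq_of_coord_eq hu) hf hper hinj h01 h1.2
    (fun s => (hx s).1.1) (fun s => (hx s).1.2) (fun s => (hx s).2.1) (fun s => (hx s).2.2)
  -- If `p` is below the top, the loop is cut at a top point. Otherwise a loop cut at `p` would make
  -- both arcs contain `p`; instead one arc starts at `p` and the other at `q`, which has the same
  -- height.
  rcases (hσ θ₀).lt_or_eq with hlt | heq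
  · obtain ⟨w, hw, hfw⟩ := exists_mem_Ico_apply_eq hT hper σ (mem_range_self ρ)
    have hne : σ ≠ w := by
      rintro rfl
      rw [hfw] at hlt
      exact hlt.not_gt hρp
    refine main σ w (σ + T) (lt_of_le_of_ne hw.1 hne) hw.2 le_rfl hσ (by rw [hper])
      (by rw [hfw]; exact hρ) (by rwa [hfw]) (by rwa [hfw]) fun _ => ⟨fun h => ?_, fun h => ?_⟩
    · exact hlt.ne (by rw [h])
    · exact hlt.ne (by rw [h, hpq'])
  · obtain ⟨w, hw, hfw⟩ := exists_mem_Ico_apply_eq hT hper θ₀ (mem_range_self ρ)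
    have hw0 : θ₀ < w := lt_of_le_of_ne hw.1 fun h => hρ0 (by rw [← hfw, h])
    have hw1 : w ≠ θ₁ := fun h => hρ1 (by rw [← hfw, h])
    rcases hw1.lt_or_gt with hlt | hgt
    · exact main θ₀ w θ₁ hw0 hlt h1.2.le (fun s => (hσ s).trans_eq heq.symm) hpq'
        (by rw [hfw]; exact hρ) (by rwa [hfw]) (by rwa [hfw]) fun h => absurd h h1.2.ne
    · exact main θ₁ w (θ₀ + T) hgt hw.2 (by linarith)
        (fun s => (hσ s).trans_eq (heq.symm.trans hpq'.symm)) (by rw [hper, hpq'])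
        (by rw [hfw]; exact hρ) (by rwa [hfw]) (by rwa [hfw]) fun h => absurd h (by linarith)

end ClosedCurve

/-! ### Countably many directions and the conclusion -/

/-- A countable family of countable subsets of the plane spans only countably many directions. -/
theorem countable_directions {C : Set (Set (EuclideanSpace ℝ (Fin 2)))} (hC : C.Countable)
    (hfin : ∀ s ∈ C, s.Countable) {u : EuclideanSpace ℝ (Fin 2)} (hu : u ≠ 0) :
    {τ : ℝ | ∃ s ∈ C, ∃ a ∈ s, ∃ c ∈ s, a ≠ c ∧
      alongCoord u a + τ * acrossCoord u a = alongCoord u c + τ * acrossCoord u c}.Countable := by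
  have : {τ : ℝ | ∃ s ∈ C, ∃ a ∈ s, ∃ c ∈ s, a ≠ c ∧
      alongCoord u a + τ * acrossCoord u a = alongCoord u c + τ * acrossCoord u c} =
      ⋃ s ∈ C, ⋃ a ∈ s, ⋃ c ∈ s, {τ : ℝ | a ≠ c ∧
        alongCoord u a + τ * acrossCoord u a = alongCoord u c + τ * acrossCoord u c} := by
    ext τ
    simp only [mem_iUnion, mem_ofPred_eq, exists_prop]
  rw [this]
  refine hC.biUnion fun s hs => (hfin s hs).biUnion fun a _ => (hfin s hs).biUnion fun c _ =>
    Set.Subsingleton.countable ?_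
  rintro τ ⟨hac, h⟩ τ' ⟨-, h'⟩
  by_contra hne
  -- Two parameters for the same chord would make both of its coordinate differences vanish.
  have hy : acrossCoord u a = acrossCoord u c :=
    mul_left_cancel₀ (sub_ne_zero.2 hne) (by linear_combination h - h')
  exact hac (eq_of_coord_eq hu a c (by rw [hy] at h; linarith) hy)

theorem exists_dist_max {V : Type*} [PseudoMetricSpace V] {K : Set V} (hK : IsCompact K)
    (hne : K.Nonempty) : ∃ p ∈ K, ∃ q ∈ K, ∀ z ∈ K, ∀ z' ∈ K, dist z z' ≤ dist p q := by
  obtain ⟨z, hz, hmax⟩ := (hK.prod hK).exists_isMaxOn (hne.prod hne)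
    (f := fun z => dist z.1 z.2) continuous_dist.continuousOn
  exact ⟨z.1, hz.1, z.2, hz.2, fun w hw w' hw' => hmax (mk_mem_prod hw hw')⟩

theorem mainTheorem2 (γ : Circle → EuclideanSpace ℝ (Fin 2)) (hγ : IsJordanCurve γ) :
    ¬ (inscribedRhombi γ).Countable := by
  intro hC
  obtain ⟨hγc, hγi⟩ := hγ
  let f : ℝ → EuclideanSpace ℝ (Fin 2) := fun s => γ (Circle.exp s)
  have hf : Continuous f := hγc.comp Circle.exp.continuous
  have hT : 0 < 2 * Real.pi := Real.two_pi_pos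
  have hper : Function.Periodic f (2 * Real.pi) := fun s => congrArg γ (Circle.periodic_exp s)
  have hrange : range f = range γ := Circle.exp_surjective.range_comp γ
  have hinj : ∀ s t, f s = f t → |s - t| < 2 * Real.pi → s = t := by
    intro s t h hlt
    have h1 : Circle.exp (s - t) = 1 := by rw [Circle.exp_sub, hγi h, div_self']
    obtain ⟨n, hn⟩ := Circle.exp_eq_one.1 h1
    rw [hn, abs_mul, abs_of_pos hT, mul_lt_iff_lt_one_left hT] at hlt
    have : n = 0 := Int.abs_lt_one_iff.1 (by exact_mod_cast hlt)
    rw [this] at hn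
    simp only [Int.cast_zero, zero_mul] at hn
    linarith
  have hK : IsCompact (range f) := hrange ▸ isCompact_range hγc
  obtain ⟨p, hp, q, hq, hdiam⟩ := exists_dist_max hK (range_nonempty f)
  have hpq : p ≠ q := by
    rintro rfl
    have h := hdiam _ (mem_range_self 0) _ (mem_range_self Real.pi)
    rw [dist_self, dist_le_zero] at h
    have := hinj _ _ h (by
      rw [zero_sub, abs_neg, abs_of_pos Real.pi_pos]; linarith [Real.pi_pos])
    exact Real.pi_ne_zero this.symm
  -- Exchanging `p` and `q` turns the axes by a half turn, so the curve may be assumed to dip below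
  -- the diameter.
  obtain ⟨p, q, hp, hq, hpq, hdiam, hbelow⟩ : ∃ p q, p ∈ range f ∧ q ∈ range f ∧ p ≠ q ∧
      (∀ z ∈ range f, ∀ z' ∈ range f, dist z z' ≤ dist p q) ∧
      ∃ s, acrossCoord (q - p) (f s) < acrossCoord (q - p) p := by
    obtain ⟨s, hs⟩ := exists_acrossCoord_ne hf hT hper hinj hp hq hpq
    rcases hs.lt_or_gt with h | h
    · exact ⟨p, q, hp, hq, hpq, hdiam, s, h⟩
    · refine ⟨q, p, hq, hp, hpq.symm, by rwa [dist_comm q p], s, ?_⟩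
      rw [acrossCoord_swap p q, acrossCoord_swap p q, acrossCoord_sub_left]
      exact neg_lt_neg h
  have hu : q - p ≠ 0 := sub_ne_zero.2 hpq.symm
  have hev := eventually_exists_orthogonal_chords_of_diameter hf hT hper hinj hp hq hpq hdiam
    hbelow
  have hcount := countable_directions hC (fun s hs => by
    obtain ⟨⟨a, b, c, d, -, -, -, -, -, -, -, -, -, rfl⟩, -⟩ := hs
    exact (toFinite _).countable) hu
  -- The complement of a countable set is dense, so some admissible `τ` is a direction of no rhombus
  -- in the countable family.
  obtain ⟨τ, hτ, hmem⟩ := mem_closure_iff_nhds.1 (hcount.dense_compl ℝ (0 : ℝ)) _ hev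
  obtain ⟨a, ha, c, hc, b, hb, d, hd, hac, hbd, h1, h2, h3, h4⟩ := hτ
  have hS : ({a, b, c, d} : Set (EuclideanSpace ℝ (Fin 2))) ∈ inscribedRhombi γ → False :=
    fun hS => hmem ⟨_, hS, a, by simp, c, by simp, hac, h1⟩
  refine hS ⟨?_, ?_⟩
  · simp only [alongCoord, acrossCoord] at h1 h2 h3 h4
    -- `m` and `n` are the coefficients of the linear form `alongCoord + τ * acrossCoord`, and `m² +
    -- n² = (1 + τ²) ‖q - p‖²`.
    refine isRhombus_of_diagonals (m := (q - p) 0 - τ * (q - p) 1)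
      (n := (q - p) 1 + τ * (q - p) 0) ?_ hac hbd (by linear_combination h1)
      (by linear_combination h2) (by linear_combination h3) (by linear_combination h4)
    by_contra! h0
    have := sq_add_sq_pos_of_ne_zero hu
    have h5 : (1 + τ ^ 2) * ((q - p) 0 ^ 2 + (q - p) 1 ^ 2) = 0 := by
      linear_combination ((q - p) 0 - τ * (q - p) 1) * h0.1
        + ((q - p) 1 + τ * (q - p) 0) * h0.2
    have h6 : 0 < 1 + τ ^ 2 := by positivity
    exact (mul_pos h6 this).ne' h5
  · rw [← hrange]
    rintro z (rfl | rfl | rfl | rfl) <;> assumption
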